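/- Let $d\ge 2$, let $G$ be a finite group of order $r$, and let $\rho\colon G\to O(d)$ be a faithful and absolutely irreducible representation (that is, $\rho$ is injective and the representation of $G$ on $\mathbb{C}^d$ by the same matrices is irreducible). Put $N=(r-2)(d+1)+2$. Then there is a dense open subset $U$ of $(\mathbb{R}^d)^N$ whose complement has Lebesgue measure zero such that every $(p_1,\dots,p_N)\in U$ consists of $N$ distinct points and has the following property. There are a $d$-dimensional convex polytope $P\subset\mathbb{R}^d$ with exactly $r$ vertices, a partition of $\{p_1,\dots,p_N\}$ into non-empty sets $A_1,\dots,A_r$, and points $x_1\in\operatorname{Conv}(A_1),\dots,x_r\in\operatorname{Conv}(A_r)$, such that 1. $\{x_1,\dots,x_r\}$ is the vertex set of $P$; 2. $P$ is vertex-transitive, that is, the group $\operatorname{Iso}(P)$ of isometries of $\mathbb{R}^d$ mapping $P$ onto itself acts transitively on the vertices of $P$; 3. $\operatorname{Iso}(P)=G$ via $\rho$, that is, for some $a\in\mathbb{R}^d$ the elements of $\operatorname{Iso}(P)$ are exactly the maps $y\mapsto a+\rho(g)(y-a)$ with $g\in G$. -/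

import Mathlib

noncomputable section

namespace OrbitTverberg

open MeasureTheory

/-- Euclidean space `ℝ^d`. -/
abbrev E (d : ℕ) : Type := EuclideanSpace ℝ (Fin d)

/-! ### Generic point sets -/

/-- A property `Q` of `N`-element subsets of `ℝ^d` holds for generic sets of `N` points if there is
a dense open set of `N`-tuples, of full Lebesgue measure in `(ℝ^d)^N`, such that every tuple in it
consists of `N` distinct points and the set of these points has the property `Q`. -/
def GenericSet (d N : ℕ) (Q : Set (E d) → Prop) : Prop :=
  ∃ U : Set (Fin N → E d), IsOpen U ∧ Dense U ∧ volume Uᶜ = 0 ∧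
    ∀ p ∈ U, Function.Injective p ∧ Q (Set.range p)

/-! ### Polytopes -/

/-- A convex polytope: the convex hull of finitely many points. -/
def IsPolytope {d : ℕ} (P : Set (E d)) : Prop :=
  ∃ S : Set (E d), S.Finite ∧ P = convexHull ℝ S

/-- The vertices of a polytope are its extreme points. -/
def vertexSet {d : ℕ} (P : Set (E d)) : Set (E d) := P.extremePoints ℝ

/-- A full-dimensional polytope in `ℝ^d` with exactly `r` vertices. -/
structure IsPolytopeOn {d : ℕ} (r : ℕ) (P : Set (E d)) : Prop where
  isPolytope : IsPolytope P
  fullDimensional : affineSpan ℝ P = ⊤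
  finite_vertexSet : (vertexSet P).Finite
  card_vertexSet : (vertexSet P).ncard = r

/-- The isometry group of `P`: all isometries of `ℝ^d` which map `P` onto itself. -/
def isometryGroup {d : ℕ} (P : Set (E d)) : Subgroup (E d ≃ᵢ E d) where
  carrier := {φ | φ '' P = P}
  mul_mem' := by
    intro φ ψ hφ hψ
    simp only [Set.mem_ofPred_eq] at hφ hψ ⊢
    rw [IsometryEquiv.coe_mul, Set.image_comp, hψ, hφ]
  one_mem' := by
    simp
  inv_mem' := by
    intro φ hφ
    simp only [Set.mem_ofPred_eq] at hφ ⊢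
    conv_lhs => rw [← hφ]
    rw [← Set.image_comp, ← IsometryEquiv.coe_mul, inv_mul_cancel, IsometryEquiv.coe_one,
      Set.image_id]

/-- `P` is vertex-transitive: its isometry group acts transitively on its vertices. -/
def IsVertexTransitive {d : ℕ} (P : Set (E d)) : Prop :=
  ∀ v ∈ vertexSet P, ∀ w ∈ vertexSet P, ∃ φ ∈ isometryGroup P, φ v = w

/-- The set `X` can be `P`-partitioned, for a polytope `P` on `r` vertices: there are a partition
`A₁, …, A_r` of `X` and points `x_i ∈ Conv(A_i)` such that `{x₁, …, x_r}` is the vertex set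
of `P`. -/
def CanBePartitioned {d : ℕ} (r : ℕ) (P X : Set (E d)) : Prop :=
  ∃ A : Fin r → Set (E d),
    (∀ i, (A i).Nonempty) ∧ Pairwise (fun i j => Disjoint (A i) (A j)) ∧ ⋃ i, A i = X ∧
    ∃ x : Fin r → E d, (∀ i, x i ∈ convexHull ℝ (A i)) ∧ Set.range x = vertexSet P

/-! ### Orthogonal representations -/

section Representations

variable {G : Type*} [Group G] {d : ℕ}

/-- The complexification of an orthogonal representation: `G` acts on `ℂ^d` by the same
matrices. -/
def complexification (ρ : G →* Matrix.orthogonalGroup (Fin d) ℝ) :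
    Representation ℂ G (Fin d → ℂ) where
  toFun g := Matrix.toLin' ((ρ g : Matrix (Fin d) (Fin d) ℝ).map (fun t : ℝ => (t : ℂ)))
  map_one' := by
    rw [map_one, OneMemClass.coe_one, Matrix.map_one _ Complex.ofReal_zero Complex.ofReal_one,
      Matrix.toLin'_one]
    rfl
  map_mul' g h := by
    rw [map_mul, Submonoid.coe_mul]
    have := Matrix.map_mul (L := (ρ g : Matrix (Fin d) (Fin d) ℝ))
      (M := (ρ h : Matrix (Fin d) (Fin d) ℝ)) (f := Complex.ofRealHom)
    rw [show ((ρ g : Matrix (Fin d) (Fin d) ℝ) * (ρ h : Matrix (Fin d) (Fin d) ℝ)).map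
      (fun t : ℝ => (t : ℂ)) = _ from this, Matrix.toLin'_mul]
    rfl

/-- `ρ` is absolutely irreducible: it is irreducible as a representation over `ℂ`. -/
def IsAbsolutelyIrreducible (ρ : G →* Matrix.orthogonalGroup (Fin d) ℝ) : Prop :=
  (complexification ρ).IsIrreducible

/-- `Iso(P) = G` by means of the representation `ρ`: for some centre `a`, the isometries of `P` are
exactly the maps `y ↦ a + g · (y - a)` with `g ∈ G`. -/
def IsometryGroupEq (ρ : G →* Matrix.orthogonalGroup (Fin d) ℝ) (P : Set (E d)) : Prop :=
  ∃ a : E d, ∀ φ : E d ≃ᵢ E d, φ ∈ isometryGroup P ↔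
    ∃ g : G, ∀ y : E d,
      φ y = a + Matrix.toEuclideanLin (ρ g : Matrix (Fin d) (Fin d) ℝ) (y - a)

end Representations

end OrbitTverberg

end

/-! Write V = ℝ^d and `σ` for the action of G. In V^G × ℝ^G the orbit configurations g ↦ a + σ g v
with a constant weight t form a subspace W of dimension 2d + 1, so the quotient has dimension r(d+1)
- 2d - 1 = N - 1. Placing p_j with weight 1 in slot g gives r vectors for each j, whose sum is a
constant configuration and so lies in W. Colourful Carathéodory, with N colour classes in dimension
N - 1, picks one slot for each j and a convex combination lying in W. This is the partition, and it
exists for every p (`SpansEnd.exists_partition`).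

Genericity only serves to give the orbit polytope r vertices and no extra isometries. By Burnside's
theorem, absolute irreducibility makes the real matrices ρ(g) span all matrices. Hence a self-map of
G preserving the Gram matrices of all orbits is a left translation (`SpansEnd.eq_mul_of_inner_eq`),
and the vectors v for which this or freeness of the orbit fails lie in a closed null set B. The
tuples p admitting a partition with v in B form a closed set, since the weights range over a compact
set. It is null because N is exact: solving for one point of each part, such p are parametrized by
Nd real numbers that include v. -/

noncomputable section

namespace OrbitTverberg

open MeasureTheory

/-! ### Burnside's theorem and the orthogonal action -/

section Representations

variable {G : Type*} [Group G] {d : ℕ}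

/-- **Burnside's theorem** for a finite group: the operators of an irreducible representation over
an algebraically closed field span all linear operators. -/
theorem exists_sum_smul_eq_of_isIrreducible {k V : Type*} [Fintype G] [Field k] [IsAlgClosed k]
    [AddCommGroup V] [Module k V] [FiniteDimensional k V] (τ : Representation k G V)
    [τ.IsIrreducible] (M : V →ₗ[k] V) : ∃ c : G → k, ∀ v, M v = ∑ g, c g • τ g v := by
  -- By Schur's lemma the commutant consists of scalars, so every `M` commutes with it and Jacobson
  -- density applies to a finite spanning set.
  have hbij : Function.Bijective (algebraMap k (Module.End (MonoidAlgebra k G) τ.asModule)) :=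
    IsSimpleModule.algebraMap_end_bijective_of_isAlgClosed k
  let M' : Module.End (Module.End (MonoidAlgebra k G) τ.asModule) τ.asModule :=
    { toFun := fun x => τ.asModuleEquiv.symm (M (τ.asModuleEquiv x))
      map_add' := by simp
      map_smul' := by
        intro φ x
        obtain ⟨t, rfl⟩ := hbij.2 φ
        simp }
  obtain ⟨s, hs⟩ := (Module.Finite.fg_top : (⊤ : Submodule k τ.asModule).FG)
  obtain ⟨a, ha⟩ := jacobson_density M' s
  have key : ∀ x : τ.asModule, M (τ.asModuleEquiv x) = τ.asAlgebraHom a (τ.asModuleEquiv x) := by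
    intro x
    have hx : x ∈ Submodule.span k (s : Set τ.asModule) := hs ▸ Submodule.mem_top
    induction hx using Submodule.span_induction with
    | mem m hm =>
      have := congrArg τ.asModuleEquiv (ha m hm)
      rw [τ.asModuleEquiv_map_smul] at this
      simpa [M'] using this
    | zero => simp
    | add _ _ _ _ h₁ h₂ => simp only [map_add, h₁, h₂]
    | smul t _ _ h => simp only [map_smul, h]
  refine ⟨fun g => a.coeff g, fun v => ?_⟩
  have := key (τ.asModuleEquiv.symm v)
  rw [LinearEquiv.apply_symm_apply] at this
  rw [this, Representation.asAlgebraHom_def, MonoidAlgebra.lift_apply,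
    Finsupp.sum_fintype _ _ (by simp)]
  simp [LinearMap.sum_apply]

/-- The orthogonal operators by which `G` acts on `ℝ^d`. -/
def orthogonalAction (ρ : G →* Matrix.orthogonalGroup (Fin d) ℝ) : G →* (E d ≃ₗᵢ[ℝ] E d) where
  toFun g :=
    { toLinearEquiv := LinearEquiv.ofLinearMap
        (Matrix.toEuclideanLin (ρ g : Matrix (Fin d) (Fin d) ℝ))
        (Matrix.toEuclideanLin (ρ g⁻¹ : Matrix (Fin d) (Fin d) ℝ))
        (by
          rw [← Matrix.toLpLin_mul_same, ← Submonoid.coe_mul, ← map_mul]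
          simp)
        (by
          rw [← Matrix.toLpLin_mul_same, ← Submonoid.coe_mul, ← map_mul]
          simp)
      norm_map' := by
        intro x
        have h : (star (ρ g : Matrix (Fin d) (Fin d) ℝ)) * (ρ g : Matrix (Fin d) (Fin d) ℝ) = 1 :=
          Matrix.UnitaryGroup.star_mul_self (ρ g)
        rw [← sq_eq_sq₀ (norm_nonneg _) (norm_nonneg _), ← real_inner_self_eq_norm_sq,
          ← real_inner_self_eq_norm_sq]
        change inner ℝ (Matrix.toEuclideanLin (ρ g : Matrix (Fin d) (Fin d) ℝ) x)
          (Matrix.toEuclideanLin (ρ g : Matrix (Fin d) (Fin d) ℝ) x) = _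
        rw [← LinearMap.adjoint_inner_right, ← Matrix.toEuclideanLin_conjTranspose_eq_adjoint,
          ← LinearMap.comp_apply, ← Matrix.toLpLin_mul_same, ← Matrix.star_eq_conjTranspose, h]
        simp }
  map_one' := by ext; simp
  map_mul' g h := by ext; simp


theorem orthogonalAction_apply (ρ : G →* Matrix.orthogonalGroup (Fin d) ℝ) (g : G) (v : E d) :
    orthogonalAction ρ g v = Matrix.toEuclideanLin (ρ g : Matrix (Fin d) (Fin d) ℝ) v := rfl

theorem orthogonalAction_injective {ρ : G →* Matrix.orthogonalGroup (Fin d) ℝ}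
    (hρ : Function.Injective ρ) : Function.Injective (orthogonalAction ρ) := by
  intro g h hgh
  apply hρ
  apply Subtype.ext
  apply Matrix.toEuclideanLin.injective
  ext1 v
  exact congrArg (fun φ : E d ≃ₗᵢ[ℝ] E d => φ v) hgh

end Representations

/-! ### Consequences of spanning all operators; recovering G from its orbits -/

section Spanning

variable {G V : Type*} [Group G] [Fintype G] [NormedAddCommGroup V] [InnerProductSpace ℝ V]

/-- The operators `σ g` span all linear operators on `V`. -/
def SpansEnd (σ : G →* (V ≃ₗᵢ[ℝ] V)) : Prop :=
  ∀ M : V →ₗ[ℝ] V, ∃ c : G → ℝ, ∀ v, M v = ∑ g, c g • σ g v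

theorem spansEnd_orthogonalAction {d : ℕ} {ρ : G →* Matrix.orthogonalGroup (Fin d) ℝ}
    (hρ : IsAbsolutelyIrreducible ρ) : SpansEnd (orthogonalAction ρ) := by
  intro M
  have : (complexification ρ).IsIrreducible := hρ
  let A : Matrix (Fin d) (Fin d) ℝ := Matrix.toEuclideanLin.symm M
  obtain ⟨c, hc⟩ := exists_sum_smul_eq_of_isIrreducible (complexification ρ)
    (Matrix.toLin' (A.map (fun t : ℝ => (t : ℂ))))
  -- All matrices are real, so the real parts of the complex coefficients already suffice.
  have hA : A = ∑ g, (c g).re • (ρ g : Matrix (Fin d) (Fin d) ℝ) := by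
    ext i j
    have := congrArg Complex.re (congrFun (hc (Pi.single j 1)) i)
    simpa [complexification, Matrix.sum_apply] using this
  refine ⟨fun g => (c g).re, fun v => ?_⟩
  have hM : M = Matrix.toEuclideanLin A := by simp [A]
  rw [hM, hA]
  simp [orthogonalAction_apply]

variable {σ : G →* (V ≃ₗᵢ[ℝ] V)}

theorem SpansEnd.exists_sum_smul_apply_eq (hσ : SpansEnd σ) {w : V} (hw : w ≠ 0) (z : V) :
    ∃ c : G → ℝ, ∑ g, c g • σ g w = z := by
  obtain ⟨c, hc⟩ := hσ ((innerₛₗ ℝ w).smulRight ((inner ℝ w w)⁻¹ • z))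
  refine ⟨c, ?_⟩
  rw [← hc]
  simp [smul_smul, hw]

theorem exists_notMem_span_singleton (hdim : 1 < Module.finrank ℝ V) (w : V) :
    ∃ z, z ∉ Submodule.span ℝ {w} := by
  by_contra! h
  have htop : Submodule.span ℝ {w} = ⊤ := Submodule.eq_top_iff'.2 h
  have := finrank_span_le_card (R := ℝ) ({w} : Set V)
  rw [htop, finrank_top] at this
  simp at this
  omega

/-- The orbit of a nonzero vector spans V, whereas an invariant vector spans at most a line. -/
theorem SpansEnd.eq_zero_of_invariant (hσ : SpansEnd σ) (hdim : 1 < Module.finrank ℝ V) {w : V}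
    (hw : ∀ g, σ g w = w) : w = 0 := by
  by_contra h0
  obtain ⟨z, hz⟩ := exists_notMem_span_singleton hdim w
  obtain ⟨c, hc⟩ := hσ.exists_sum_smul_apply_eq h0 z
  apply hz
  rw [← hc]
  exact Submodule.sum_mem _ fun g _ => by
    rw [hw]; exact Submodule.smul_mem _ _ (Submodule.mem_span_singleton_self w)

theorem SpansEnd.sum_apply_eq_zero (hσ : SpansEnd σ) (hdim : 1 < Module.finrank ℝ V) (v : V) :
    ∑ g, σ g v = 0 := by
  apply hσ.eq_zero_of_invariant hdim
  intro h
  rw [map_sum]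
  calc ∑ g, σ h (σ g v) = ∑ g, σ (h * g) v := by simp
    _ = ∑ g, σ g v := Fintype.sum_equiv (Equiv.mulLeft h) _ _ (fun _ => rfl)

theorem exists_linearMap_eq_eq {u v : V} (huv : u ∉ Submodule.span ℝ {v})
    (hvu : v ∉ Submodule.span ℝ {u}) (w : V) : ∃ M : V →ₗ[ℝ] V, M u = w ∧ M v = w := by
  obtain ⟨f, hf, hf'⟩ := Submodule.exists_le_ker_of_notMem huv
  obtain ⟨k, hk, hk'⟩ := Submodule.exists_le_ker_of_notMem hvu
  have h1 : f v = 0 := hf' (Submodule.mem_span_singleton_self v)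
  have h2 : k u = 0 := hk' (Submodule.mem_span_singleton_self u)
  refine ⟨((f u)⁻¹ • f + (k v)⁻¹ • k).smulRight w, ?_, ?_⟩ <;> simp [h1, h2, hf, hk]

/-- If `π` preserves all Gram matrices of orbits, then it is a left translation: the orthogonal
group `G` is recovered from a generic orbit. -/
theorem SpansEnd.eq_mul_of_inner_eq (hσ : SpansEnd σ) (hinj : Function.Injective σ)
    (hdim : 1 < Module.finrank ℝ V) {π : G → G}
    (hπ : ∀ v g h, inner ℝ (σ g v) (σ h v) = inner ℝ (σ (π g) v) (σ (π h) v)) (g : G) :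
    π g = π 1 * g := by
  -- Equal Gram matrices make T_v : ∑ c g • σ g v ↦ ∑ c g • σ (π g) v a well-defined isometry. The
  -- aim is that T_v does not depend on v.
  have hnorm : ∀ (c : G → ℝ) (v : V), ‖∑ g, c g • σ (π g) v‖ = ‖∑ g, c g • σ g v‖ := by
    intro c v
    rw [← sq_eq_sq₀ (norm_nonneg _) (norm_nonneg _), ← real_inner_self_eq_norm_sq,
      ← real_inner_self_eq_norm_sq]
    simp_rw [sum_inner, inner_sum, real_inner_smul_left, real_inner_smul_right]
    exact Finset.sum_congr rfl fun g _ => Finset.sum_congr rfl fun h _ => by rw [hπ v g h]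
  have hzero : ∀ (c : G → ℝ) (v : V), ∑ g, c g • σ g v = 0 → ∑ g, c g • σ (π g) v = 0 := by
    intro c v h
    rw [← norm_eq_zero, hnorm, h, norm_zero]
  have hsame : ∀ (c c' : G → ℝ) (v : V), ∑ g, c g • σ g v = ∑ g, c' g • σ g v →
      ∑ g, c g • σ (π g) v = ∑ g, c' g • σ (π g) v := by
    intro c c' v h
    have := hzero (c - c') v (by simp [sub_smul, h])
    simpa [sub_smul, sub_eq_zero] using this
  have hindep : ∀ (c c' : G → ℝ) (u v : V), u ∉ Submodule.span ℝ {v} → v ∉ Submodule.span ℝ {u} →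
      ∑ g, c g • σ g u = ∑ g, c' g • σ g v → ∑ g, c g • σ (π g) u = ∑ g, c' g • σ (π g) v := by
    intro c c' u v huv hvu h
    -- An operator sending u and v to the same vector kills u - v. By `hzero`, so does its
    -- `π`-twisted combination, whence T_u and T_v agree on that vector.
    obtain ⟨M, hMu, hMv⟩ := exists_linearMap_eq_eq huv hvu (∑ g, c g • σ g u)
    obtain ⟨b, hb⟩ := hσ M
    rw [hsame c b u (by rw [← hb, hMu]), hsame c' b v (by rw [← hb, hMv, h])]
    have := hzero b (u - v) (by rw [← hb, map_sub, hMu, hMv, sub_self])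
    simpa [smul_sub, sub_eq_zero] using this
  have hsymm : ∀ {u v : V}, u ≠ 0 → u ∉ Submodule.span ℝ {v} → v ∉ Submodule.span ℝ {u} ∨ v = 0 := by
    intro u v hu huv
    by_contra! h
    obtain ⟨a, ha⟩ := Submodule.mem_span_singleton.1 h.1
    have ha0 : a ≠ 0 := by rintro rfl; exact h.2 (by simpa using ha.symm)
    exact huv (Submodule.mem_span_singleton.2 ⟨a⁻¹, by rw [← ha, smul_smul, inv_mul_cancel₀ ha0,
      one_smul]⟩)
  have hall : ∀ (c c' : G → ℝ) (u v : V), u ≠ 0 → v ≠ 0 →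
      ∑ g, c g • σ g u = ∑ g, c' g • σ g v → ∑ g, c g • σ (π g) u = ∑ g, c' g • σ (π g) v := by
    intro c c' u v hu hv h
    by_cases huv : u ∈ Submodule.span ℝ {v}
    -- Parallel vectors are compared through a third vector off their common line.
    · obtain ⟨z, hz⟩ := exists_notMem_span_singleton hdim v
      have hzu : z ∉ Submodule.span ℝ {u} := fun hzu =>
        hz ((Submodule.span_singleton_le_iff_mem _ _).2 huv hzu)
      have hz0 : z ≠ 0 := by rintro rfl; exact hz (Submodule.zero_mem _)
      obtain ⟨b, hb⟩ := hσ.exists_sum_smul_apply_eq hz0 (∑ g, c g • σ g u)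
      rw [hindep c b u z ((hsymm hz0 hzu).resolve_right hu) hzu hb.symm,
        hindep b c' z v hz ((hsymm hz0 hz).resolve_right hv) (hb.trans h)]
    · exact hindep c c' u v huv ((hsymm hu huv).resolve_right hv) h
  apply hinj
  ext v
  by_cases hv : v = 0
  · simp [hv]
  classical
  -- Evaluate T_v = T_{σ g v} at σ g v, written as g applied to v and as 1 applied to σ g v.
  have := hall (Pi.single g 1) (Pi.single 1 1) v (σ g v) hv (by simpa using hv)
    (by simp [Pi.single_apply])
  simpa [Pi.single_apply] using this

end Spanning

/-! ### Colourful Carathéodory theorem -/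

section ColourfulCaratheodory

variable {J C V : Type*} [Fintype J] [NormedAddCommGroup V] [InnerProductSpace ℝ V]

theorem sq_norm_le_inner_of_forall_norm_le {z y : V}
    (h : ∀ t : ℝ, 0 ≤ t → t ≤ 1 → ‖z‖ ≤ ‖(1 - t) • z + t • y‖) : ‖z‖ ^ 2 ≤ inner ℝ z y := by
  have hK : Convex ℝ (segment ℝ z y) := convex_segment z y
  have hmin : ‖(0 : V) - z‖ = ⨅ w : segment ℝ z y, ‖(0 : V) - w‖ := by
    have : Nonempty (segment ℝ z y) := ⟨⟨z, left_mem_segment ℝ z y⟩⟩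
    refine le_antisymm (le_ciInf ?_) (ciInf_le ⟨0, ?_⟩ (⟨z, left_mem_segment ℝ z y⟩ : segment ℝ z y))
    · rintro ⟨w, a, b, ha, hb, hab, rfl⟩
      have := h b hb (by linarith)
      rw [← hab, add_sub_cancel_right] at this
      simpa only [zero_sub, norm_neg] using this
    · rintro _ ⟨w, rfl⟩
      exact norm_nonneg _
  have := (norm_eq_iInf_iff_real_inner_le_zero hK (left_mem_segment ℝ z y)).1 hmin y
    (right_mem_segment ℝ z y)
  rw [zero_sub, inner_neg_left, inner_sub_right, real_inner_self_eq_norm_sq] at this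
  linarith

/-- If `z` is the point of smallest norm in the convex hull of the `u j`, then all `u j` lie beyond
the hyperplane through `z` orthogonal to `z`. -/
theorem sq_norm_le_inner_of_mem_stdSimplex {u : J → V} {w : J → ℝ} (hw : w ∈ stdSimplex ℝ J)
    (hmin : ∀ w' ∈ stdSimplex ℝ J, ‖∑ j, w j • u j‖ ≤ ‖∑ j, w' j • u j‖) (j : J) :
    ‖∑ j, w j • u j‖ ^ 2 ≤ inner ℝ (∑ j, w j • u j) (u j) := by
  classical
  refine sq_norm_le_inner_of_forall_norm_le fun t ht0 ht1 => ?_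
  have := hmin ((1 - t) • w + t • Pi.single j 1)
    (convex_stdSimplex ℝ J hw (single_mem_stdSimplex ℝ j) (by linarith) ht0 (by ring))
  simpa [add_smul, Finset.sum_add_distrib, Finset.smul_sum, smul_smul, Pi.single_apply] using this

/-- Carathéodory reduction: the points lie in a hyperplane missing the origin, so a linear
dependence among them is automatically an affine one and can be subtracted until a weight vanishes.
-/
theorem exists_mem_stdSimplex_eq_zero [FiniteDimensional ℝ V]
    (hcard : Module.finrank ℝ V < Fintype.card J) {u : J → V} {w : J → ℝ}
    (hw : w ∈ stdSimplex ℝ J) (h0 : ∀ j, w j ≠ 0) {z : V} (hz : z ≠ 0)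
    (hu : ∀ j, inner ℝ z (u j) = ‖z‖ ^ 2) :
    ∃ w' ∈ stdSimplex ℝ J, ∑ j, w' j • u j = ∑ j, w j • u j ∧ ∃ j, w' j = 0 := by
  have hpos : ∀ j, 0 < w j := fun j => lt_of_le_of_ne (hw.1 j) (h0 j).symm
  obtain ⟨m, hm, j₁, hj₁⟩ : ∃ m : J → ℝ, ∑ j, m j • u j = 0 ∧ ∃ j, m j ≠ 0 := by
    have : ¬ LinearIndependent ℝ u := fun h => by
      have := h.fintype_card_le_finrank
      omega
    exact Fintype.not_linearIndependent_iff.1 this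
  have hsum : ∑ j, m j = 0 := by
    have := congrArg (fun y => inner ℝ z y) hm
    simp only [inner_sum, real_inner_smul_right, hu, inner_zero_right, ← Finset.sum_mul] at this
    exact (mul_eq_zero.1 this).resolve_right (by simpa using hz)
  have : Nonempty J := ⟨j₁⟩
  obtain ⟨j₀, hj₀⟩ := Finite.exists_max (fun j => m j / w j)
  have hmpos : 0 < m j₀ := by
    by_contra! hneg
    have hle : ∀ j, m j ≤ 0 := fun j => by
      have h1 := (hj₀ j).trans (div_nonpos_of_nonpos_of_nonneg hneg (hpos j₀).le)
      by_contra! h2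
      exact absurd (div_pos h2 (hpos j)) (not_lt.2 h1)
    exact hj₁ ((Finset.sum_eq_zero_iff_of_nonpos (fun j _ => hle j)).1 hsum j₁ (Finset.mem_univ _))
  refine ⟨fun j => w j - w j₀ / m j₀ * m j, ⟨fun j => ?_, ?_⟩, ?_, j₀, ?_⟩
  · have h1 := hj₀ j
    rw [div_le_div_iff₀ (hpos j) (hpos j₀)] at h1
    rw [sub_nonneg, div_mul_eq_mul_div, div_le_iff₀ hmpos]
    linarith
  · rw [Finset.sum_sub_distrib, ← Finset.mul_sum, hsum, mul_zero, sub_zero, hw.2]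
  · simp only [sub_smul, Finset.sum_sub_distrib, mul_smul, ← Finset.smul_sum, hm, smul_zero,
      sub_zero]
  · simp only
    rw [div_mul_cancel₀ _ hmpos.ne', sub_self]

theorem exists_rainbow_sum_eq_zero_of_inner [Nonempty C] [Fintype C] [FiniteDimensional ℝ V]
    (hcard : Module.finrank ℝ V < Fintype.card J) (φ : J → C → V) (hφ : ∀ j, ∑ c, φ j c = 0) :
    ∃ f : J → C, ∃ w ∈ stdSimplex ℝ J, ∑ j, w j • φ j (f j) = 0 := by
  classical
  have : Nonempty J := Fintype.card_pos_iff.1 (by omega)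
  have hex : ∀ f : J → C, ∃ w ∈ stdSimplex ℝ J, ∀ w' ∈ stdSimplex ℝ J,
      ‖∑ j, w j • φ j (f j)‖ ≤ ‖∑ j, w' j • φ j (f j)‖ := fun f =>
    (isCompact_stdSimplex ℝ J).exists_isMinOn (f := fun w : J → ℝ => ‖∑ j, w j • φ j (f j)‖)
      ⟨_, single_mem_stdSimplex ℝ (Classical.arbitrary J)⟩ (Continuous.continuousOn (by fun_prop))
  choose W hW hWmin using hex
  -- Take the rainbow simplex closest to the origin. If its nearest point z is nonzero, recolouring
  -- a vertex of weight zero contradicts minimality.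
  obtain ⟨f, hf⟩ := Finite.exists_min (fun f => ‖∑ j, W f j • φ j (f j)‖)
  refine ⟨f, W f, hW f, ?_⟩
  by_contra hz
  have hle := sq_norm_le_inner_of_mem_stdSimplex (hW f) (hWmin f)
  set z := ∑ j, W f j • φ j (f j) with hzdef
  obtain ⟨w, hw, hwz, j₀, hj₀⟩ : ∃ w ∈ stdSimplex ℝ J, ∑ j, w j • φ j (f j) = z ∧
      ∃ j, w j = 0 := by
    by_cases h0 : ∃ j, W f j = 0
    · exact ⟨W f, hW f, rfl, h0⟩
    push Not at h0
    apply exists_mem_stdSimplex_eq_zero hcard (hW f) h0 hz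
    have hs : ∑ j, W f j * (inner ℝ z (φ j (f j)) - ‖z‖ ^ 2) = 0 := by
      simp only [mul_sub, Finset.sum_sub_distrib, ← Finset.sum_mul, (hW f).2, one_mul]
      rw [← real_inner_self_eq_norm_sq]
      nth_rw 3 [hzdef]
      simp only [inner_sum, real_inner_smul_right, sub_self]
    intro j
    have := (Finset.sum_eq_zero_iff_of_nonneg (fun j _ =>
      mul_nonneg ((hW f).1 j) (sub_nonneg.2 (hle j)))).1 hs j (Finset.mem_univ _)
    exact sub_eq_zero.1 ((mul_eq_zero.1 this).resolve_left (h0 j))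
  -- Class `j₀` sums to zero, so it cannot lie strictly on the positive side of z.
  obtain ⟨c, hc⟩ : ∃ c, inner ℝ z (φ j₀ c) ≤ 0 := by
    by_contra! hpos
    have h1 := congrArg (fun y => inner ℝ z y) (hφ j₀)
    simp only [inner_sum, inner_zero_right] at h1
    exact absurd h1 (Finset.sum_pos (fun c _ => hpos c) Finset.univ_nonempty).ne'
  have hz' : ∑ j, w j • φ j (Function.update f j₀ c j) = z := by
    rw [← hwz]
    refine Finset.sum_congr rfl fun j _ => ?_
    by_cases hj : j = j₀
    · simp [hj, hj₀]
    · simp [hj]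
  have := sq_norm_le_inner_of_mem_stdSimplex (u := fun j => φ j (Function.update f j₀ c j)) hw
    (fun w' hw' => by
      rw [hz']
      exact (hf (Function.update f j₀ c)).trans (hWmin _ w' hw')) j₀
  rw [hz', Function.update_self] at this
  have : 0 < ‖z‖ ^ 2 := by positivity
  linarith

end ColourfulCaratheodory

/-- **Colourful Carathéodory theorem**, for colour classes with barycentre at the origin. -/
theorem exists_rainbow_sum_eq_zero {J C Q : Type*} [Fintype J] [Nonempty C] [Fintype C]
    [AddCommGroup Q] [Module ℝ Q] [FiniteDimensional ℝ Q]
    (hcard : Module.finrank ℝ Q < Fintype.card J) (φ : J → C → Q) (hφ : ∀ j, ∑ c, φ j c = 0) :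
    ∃ f : J → C, ∃ w ∈ stdSimplex ℝ J, ∑ j, w j • φ j (f j) = 0 := by
  let e : Q ≃ₗ[ℝ] EuclideanSpace ℝ (Fin (Module.finrank ℝ Q)) :=
    LinearEquiv.ofFinrankEq _ _ (by simp)
  obtain ⟨f, w, hw, h⟩ := exists_rainbow_sum_eq_zero_of_inner (by simpa using hcard)
    (fun j c => e (φ j c)) (fun j => by rw [← map_sum, hφ, map_zero])
  refine ⟨f, w, hw, e.injective ?_⟩
  simpa using h

/-! ### Every point family has an orbit partition -/

section Partition

variable {G V : Type*} [Group G] [Fintype G] [NormedAddCommGroup V]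
  [InnerProductSpace ℝ V] {σ : G →* (V ≃ₗᵢ[ℝ] V)}

/-- The weighted orbit configurations: `(a, v, t)` is sent to the family of points `a + σ g v`,
each with the weight `t`. -/
def orbitMap (σ : G →* (V ≃ₗᵢ[ℝ] V)) : V × V × ℝ →ₗ[ℝ] (G → V) × (G → ℝ) where
  toFun x := (fun g => x.1 + σ g x.2.1, fun _ => x.2.2)
  map_add' x y := by
    ext g
    · simp only [Prod.fst_add, Prod.snd_add, map_add, Pi.add_apply]; abel
    · simp
  map_smul' t x := by ext g <;> simp

theorem SpansEnd.orbitMap_injective (hσ : SpansEnd σ) (hdim : 1 < Module.finrank ℝ V) :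
    Function.Injective (orbitMap σ) := by
  rw [← LinearMap.ker_eq_bot, LinearMap.ker_eq_bot']
  rintro ⟨a, v, t⟩ h
  have h1 : ∀ g, a + σ g v = 0 := fun g => congrFun (congrArg Prod.fst h) g
  have ht : t = 0 := congrFun (congrArg Prod.snd h) 1
  have ha : a = 0 := by
    have : ∑ g, (a + σ g v) = 0 := Finset.sum_eq_zero fun g _ => h1 g
    rw [Finset.sum_add_distrib, hσ.sum_apply_eq_zero hdim, add_zero, Finset.sum_const,
      Finset.card_univ, ← Nat.cast_smul_eq_nsmul ℝ] at this
    exact (smul_eq_zero.1 this).resolve_left (by simp)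
  have hv : v = 0 := by simpa [ha] using h1 1
  rw [ha, hv, ht]; rfl

/-- Any sufficiently many points can be partitioned so that suitable points in the convex hulls of
the parts form an orbit. -/
theorem SpansEnd.exists_partition [DecidableEq G] [FiniteDimensional ℝ V] (hσ : SpansEnd σ)
    (hdim : 1 < Module.finrank ℝ V) {J : Type*} [Fintype J]
    (hJ : Fintype.card G * (Module.finrank ℝ V + 1) ≤ Fintype.card J + 2 * Module.finrank ℝ V)
    (p : J → V) :
    ∃ f : J → G, ∃ w : J → ℝ, (∀ j, 0 ≤ w j) ∧ (∀ g, ∑ j with f j = g, w j = 1) ∧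
      ∃ a v, ∀ g, ∑ j with f j = g, w j • p j = a + σ g v := by
  let W := LinearMap.range (orbitMap σ)
  have hW : Module.finrank ℝ W = 2 * Module.finrank ℝ V + 1 := by
    rw [LinearMap.finrank_range_of_inj (hσ.orbitMap_injective hdim)]
    simp [two_mul, add_assoc]
  have hQ := W.finrank_quotient_add_finrank
  rw [hW] at hQ
  simp only [Module.finrank_prod, Module.finrank_pi_fintype, Finset.sum_const, Finset.card_univ,
    smul_eq_mul, Module.finrank_self, ← mul_add] at hQ
  obtain ⟨f, w, hw, h⟩ := exists_rainbow_sum_eq_zero (Q := ((G → V) × (G → ℝ)) ⧸ W)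
    (J := J) (C := G) (by omega)
    (fun j g => W.mkQ (Pi.single g (p j), Pi.single g 1)) (fun j => by
      rw [← map_sum, Submodule.mkQ_apply, Submodule.Quotient.mk_eq_zero]
      refine ⟨(p j, 0, 1), ?_⟩
      ext g <;> simp [orbitMap, Prod.fst_sum, Prod.snd_sum, Pi.single_apply])
  simp only [← map_smul] at h
  rw [← map_sum, Submodule.mkQ_apply, Submodule.Quotient.mk_eq_zero] at h
  obtain ⟨⟨a, v, t⟩, hat⟩ := h
  have h1 : ∀ g, ∑ j with f j = g, w j • p j = a + σ g v := fun g => by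
    have := congrFun (congrArg Prod.fst hat) g
    simp only [orbitMap, LinearMap.coe_mk, AddHom.coe_mk, Prod.fst_sum, Prod.smul_fst,
      Finset.sum_apply, Pi.smul_apply] at this
    rw [this, Finset.sum_filter]
    refine Finset.sum_congr rfl fun j _ => ?_
    by_cases hj : f j = g
    · subst hj; simp
    · simp [hj, Ne.symm hj]
  have h2 : ∀ g, ∑ j with f j = g, w j = t := fun g => by
    have := congrFun (congrArg Prod.snd hat) g
    simp only [orbitMap, LinearMap.coe_mk, AddHom.coe_mk, Prod.snd_sum, Prod.smul_snd,
      Finset.sum_apply, Pi.smul_apply] at this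
    rw [this, Finset.sum_filter]
    refine Finset.sum_congr rfl fun j _ => ?_
    by_cases hj : f j = g
    · subst hj; simp
    · simp [hj, Ne.symm hj]
  have ht : (Fintype.card G : ℝ) * t = 1 := by
    rw [← hw.2, ← Finset.sum_fiberwise Finset.univ f w]
    simp [h2]
  -- Each fibre has total weight 1/r; rescaling by r makes the combinations convex.
  set r : ℝ := (Fintype.card G : ℝ) with hr
  refine ⟨f, fun j => r * w j, fun j => mul_nonneg (by positivity) (hw.1 j), fun g => ?_,
    r • a, r • v, fun g => ?_⟩
  · rw [← Finset.mul_sum, h2, ht]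
  · simp only [mul_smul, ← Finset.smul_sum, h1, smul_add, map_smul]

end Partition

/-! ### Generic vectors -/

section Generic

variable {V : Type*} [NormedAddCommGroup V] [InnerProductSpace ℝ V] [FiniteDimensional ℝ V]
  [MeasurableSpace V] [BorelSpace V] (ν : Measure V) [ν.IsAddHaarMeasure]

/-- On each line in direction u, q is a polynomial with leading coefficient q u ≠ 0, so it has
finitely many zeros; Fubini does the rest. -/
theorem measure_zeros_eq_zero_of_quadratic {q : V → ℝ} (hq : Continuous q) {u : V} (hu : q u ≠ 0)
    (b : V → ℝ) (hb : ∀ v (t : ℝ), q (v + t • u) = q v + t * b v + t ^ 2 * q u) :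
    ν {v | q v = 0} = 0 := by
  have hs : MeasurableSet {v | q v ≠ 0} := (isOpen_ne_fun hq continuous_const).measurableSet
  have h := (ae_ae_add_linearMap_mem_iff (LinearMap.toSpanSingleton ℝ V u) volume ν hs).1
    (Filter.Eventually.of_forall fun v => by
      let P : Polynomial ℝ := Polynomial.C (q u) * Polynomial.X ^ 2 +
        Polynomial.C (b v) * Polynomial.X + Polynomial.C (q v)
      have hP : P ≠ 0 := fun h0 => by
        have := congrArg (fun R : Polynomial ℝ => R.coeff 2) h0
        simp [P] at this
        exact hu this
      refine measure_mono_null (fun t ht => ?_)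
        ((Polynomial.finite_setOfPred_isRoot hP).measure_zero volume)
      have ht' : q (v + t • u) = 0 := by simpa using ht
      rw [hb] at ht'
      simp only [Set.mem_ofPred_eq, Polynomial.IsRoot.def, P, Polynomial.eval_add,
        Polynomial.eval_mul, Polynomial.eval_C, Polynomial.eval_pow, Polynomial.eval_X]
      linarith)
  simpa [ae_iff] using h

variable {G : Type*} [Group G] [Fintype G] {σ : G →* (V ≃ₗᵢ[ℝ] V)}

/-- A generic vector has trivial stabilizer, and every permutation of its orbit which preserves
inner products comes from the group. -/
theorem SpansEnd.exists_isClosed_measure_eq_zero (hσ : SpansEnd σ) (hinj : Function.Injective σ)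
    (hdim : 1 < Module.finrank ℝ V) : ∃ B : Set V, IsClosed B ∧ ν B = 0 ∧ ∀ v ∉ B,
      Function.Injective (fun g => σ g v) ∧
      ∀ π : G → G, (∀ g h, inner ℝ (σ g v) (σ h v) = inner ℝ (σ (π g) v) (σ (π h) v)) →
        ∀ g, π g = π 1 * g := by
  classical
  let B₁ : Set V := ⋃ g : {g : G // g ≠ 1}, {v | σ g v = v}
  let q : (G → G) → G → G → V → ℝ := fun π g h v =>
    inner ℝ (σ g v) (σ h v) - inner ℝ (σ (π g) v) (σ (π h) v)
  have hq : ∀ π g h, Continuous (q π g h) := fun π g h =>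
    ((σ g).continuous.inner (σ h).continuous).sub
      ((σ (π g)).continuous.inner (σ (π h)).continuous)
  let B₂ : Set V := ⋃ π : {π : G → G // ¬ ∀ g, π g = π 1 * g}, ⋂ g, ⋂ h, {v | q π g h v = 0}
  refine ⟨B₁ ∪ B₂, IsClosed.union ?_ ?_, measure_union_null ?_ ?_, fun v hv => ⟨?_, ?_⟩⟩
  · exact isClosed_iUnion_of_finite fun g => isClosed_eq (σ g).continuous continuous_id
  · exact isClosed_iUnion_of_finite fun π => isClosed_iInter fun g => isClosed_iInter fun h =>
      isClosed_eq (hq π g h) continuous_const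
  · refine measure_iUnion_null fun g => ?_
    have hne : LinearMap.eqLocus (σ g).toLinearEquiv.toLinearMap LinearMap.id ≠ ⊤ := by
      intro htop
      apply g.2
      apply hinj
      ext v
      have : v ∈ LinearMap.eqLocus (σ g).toLinearEquiv.toLinearMap LinearMap.id := by
        rw [htop]; trivial
      simpa using this
    exact Measure.addHaar_submodule ν _ hne
  · refine measure_iUnion_null fun π => ?_
    obtain ⟨u, g, h, hu⟩ : ∃ u g h, q π g h u ≠ 0 := by
      by_contra! h0
      exact π.2 (hσ.eq_mul_of_inner_eq hinj hdim fun v g h => sub_eq_zero.1 (h0 v g h))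
    refine measure_mono_null (Set.iInter_subset_of_subset g (Set.iInter_subset _ h))
      (measure_zeros_eq_zero_of_quadratic ν (hq π g h) hu
        (fun v => inner ℝ (σ g v) (σ h u) + inner ℝ (σ g u) (σ h v) -
          inner ℝ (σ (π.1 g) v) (σ (π.1 h) u) - inner ℝ (σ (π.1 g) u) (σ (π.1 h) v)) ?_)
    intro v t
    simp only [q, map_add, map_smul, inner_add_left, inner_add_right, real_inner_smul_left,
      real_inner_smul_right]
    ring
  · intro g h hgh
    by_contra hne
    refine hv (Or.inl (Set.mem_iUnion.2 ⟨⟨g⁻¹ * h, ?_⟩, ?_⟩))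
    · rwa [ne_eq, inv_mul_eq_one]
    · have : σ h v = σ g v := hgh.symm
      simp [this]
  · intro π hπ
    by_contra hne
    refine hv (Or.inr (Set.mem_iUnion.2 ⟨⟨π, hne⟩, ?_⟩))
    simp only [Set.mem_iInter]
    exact fun g h => sub_eq_zero.2 (hπ g h)

end Generic

/-! ### Point families with a degenerate orbit partition -/

section Degenerate

theorem sum_fiber_eq_add {G J M : Type*} [DecidableEq G] [Fintype J] [AddCommGroup M]
    {f : J → G} {s : G → J}
    (hs : ∀ g, f (s g) = g) [DecidablePred (· ∈ Set.range s)] (h : J → M) (g : G) :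
    ∑ j with f j = g, h j = h (s g) +
      ∑ j with f j = g, if j ∈ Set.range s then 0 else h j := by
  rw [← sub_eq_iff_eq_add, ← Finset.sum_sub_distrib, Finset.sum_eq_single (s g)]
  · simp
  · intro j hj hne
    have hj' : f j = g := (Finset.mem_filter.1 hj).2
    have : j ∉ Set.range s := by
      rintro ⟨g', rfl⟩
      rw [hs] at hj'
      exact hne (by rw [hj'])
    simp [this]
  · intro h
    exact absurd (by simp [hs g]) h

variable {V : Type*} [NormedAddCommGroup V] [InnerProductSpace ℝ V]
  {G : Type*} [Group G] [Fintype G] [DecidableEq G] {σ : G →* (V ≃ₗᵢ[ℝ] V)} {J : Type*} [Fintype J]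

/-- The families of points with a partition such that suitable points in the convex hulls of the
parts form an orbit of an element of `B`. -/
def orbitPartitionSet (σ : G →* (V ≃ₗᵢ[ℝ] V)) (f : J → G) (B : Set V) : Set (J → V) :=
  {p | ∃ w : J → ℝ, (∀ j, 0 ≤ w j) ∧ (∀ g, ∑ j with f j = g, w j = 1) ∧
    ∃ a, ∃ v ∈ B, ∀ g, ∑ j with f j = g, w j • p j = a + σ g v}

/-- The centre is the barycentre of the orbit and v = x 1 - a, so both are continuous in points and
weights. Projecting out the compact cube of weights preserves closedness. -/
theorem SpansEnd.isClosed_orbitPartitionSet (hσ : SpansEnd σ) (hdim : 1 < Module.finrank ℝ V)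
    (f : J → G) {B : Set V} (hB : IsClosed B) : IsClosed (orbitPartitionSet σ f B) := by
  let K : Set (J → ℝ) := Set.Icc 0 1
  have : CompactSpace K := isCompact_iff_compactSpace.1 isCompact_Icc
  let x : (J → V) × K → G → V := fun y g => ∑ j with f j = g, y.2.1 j • y.1 j
  let a : (J → V) × K → V := fun y => (Fintype.card G : ℝ)⁻¹ • ∑ g, x y g
  have hw : ∀ j, Continuous fun y : (J → V) × K => y.2.1 j := fun j =>
    (continuous_apply j).comp (continuous_subtype_val.comp continuous_snd)
  have hx : ∀ g, Continuous fun y => x y g := fun g =>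
    continuous_finsetSum _ fun j _ => (hw j).smul ((continuous_apply j).comp continuous_fst)
  have ha : Continuous a := by fun_prop
  let S : Set ((J → V) × K) := (⋂ g, {y | ∑ j with f j = g, y.2.1 j = 1}) ∩
    ({y | x y 1 - a y ∈ B} ∩ ⋂ g, {y | x y g = a y + σ g (x y 1 - a y)})
  have hS : IsClosed S := by
    refine IsClosed.inter (isClosed_iInter fun g => ?_)
      (IsClosed.inter (hB.preimage ((hx 1).sub ha)) (isClosed_iInter fun g => ?_))
    · exact isClosed_eq (continuous_finsetSum _ fun j _ => hw j) continuous_const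
    · exact isClosed_eq (hx g) (ha.add ((σ g).continuous.comp ((hx 1).sub ha)))
  have hset : orbitPartitionSet σ f B = Prod.fst '' S := by
    ext p
    constructor
    · rintro ⟨w, hw0, hw1, c, v, hv, h⟩
      have hwK : w ∈ K := ⟨hw0, fun j => by
        have := Finset.single_le_sum (f := w) (s := Finset.univ.filter (fun i => f i = f j))
          (fun i _ => hw0 i) (Finset.mem_filter.2 ⟨Finset.mem_univ j, rfl⟩)
        rw [hw1] at this
        exact this⟩
      have hxy : ∀ g, x (p, ⟨w, hwK⟩) g = c + σ g v := h
      have hc : a (p, ⟨w, hwK⟩) = c := by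
        simp only [a, hxy, Finset.sum_add_distrib, hσ.sum_apply_eq_zero hdim, add_zero,
          Finset.sum_const, Finset.card_univ, ← Nat.cast_smul_eq_nsmul ℝ]
        rw [inv_smul_smul₀ (by simp)]
      have hd : x (p, ⟨w, hwK⟩) 1 - a (p, ⟨w, hwK⟩) = v := by
        rw [hxy, hc]; simp
      refine ⟨(p, ⟨w, hwK⟩), ⟨Set.mem_iInter.2 hw1, ?_, Set.mem_iInter.2 fun g => ?_⟩, rfl⟩
      · rwa [Set.mem_ofPred_eq, hd]
      · rw [Set.mem_ofPred_eq, hd, hxy, hc]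
    · rintro ⟨⟨p, w, hwK⟩, ⟨h1, h2, h3⟩, rfl⟩
      rw [Set.mem_iInter] at h1 h3
      exact ⟨w, hwK.1, h1, _, _, h2, h3⟩
  rw [hset]
  exact isClosedMap_fst_of_compactSpace _ hS

variable [FiniteDimensional ℝ V] [MeasurableSpace V] [BorelSpace V]

theorem measure_orbitPartitionSet_eq_zero (ν : Measure V) [ν.IsAddHaarMeasure]
    (μ : Measure (J → V)) [μ.IsAddHaarMeasure] (f : J → G) {B : Set V} (hB : IsClosed B)
    (hB0 : ν B = 0)
    (hJ : Fintype.card G * (Module.finrank ℝ V + 1) = Fintype.card J + 2 * Module.finrank ℝ V) :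
    μ (orbitPartitionSet σ f B) = 0 := by
  classical
  -- A section `s` picks a pivot in each fibre. The other points and weights, with a and v,
  -- determine the pivot weights `D` and the pivot points, and `F` rebuilds p from them; `P` and `W`
  -- vanish at pivots.
  let K : (G → J) → Type _ := fun s => {j // j ∉ Set.range s}
  let P : ∀ s, (K s → V) × (K s → ℝ) × V × V → J → V := fun s θ j =>
    if h : j ∈ Set.range s then 0 else θ.1 ⟨j, h⟩
  let W : ∀ s, (K s → V) × (K s → ℝ) × V × V → J → ℝ := fun s θ j =>
    if h : j ∈ Set.range s then 0 else θ.2.1 ⟨j, h⟩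
  let D : ∀ s, (K s → V) × (K s → ℝ) × V × V → G → ℝ := fun s θ g => 1 - ∑ j with f j = g, W s θ j
  let F : ∀ s, (K s → V) × (K s → ℝ) × V × V → J → V := fun s θ j => if j ∈ Set.range s then
    (D s θ (f j))⁻¹ • (θ.2.2.1 + σ (f j) θ.2.2.2 - ∑ i with f i = f j, W s θ i • P s θ i)
    else P s θ j
  have hP : ∀ s j, Differentiable ℝ fun θ => P s θ j := by
    intro s j
    by_cases h : j ∈ Set.range s
    · simp only [P, dif_pos h]; fun_prop
    · simp only [P, dif_neg h]; fun_prop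
  have hW : ∀ s j, Differentiable ℝ fun θ => W s θ j := by
    intro s j
    by_cases h : j ∈ Set.range s
    · simp only [W, dif_pos h]; fun_prop
    · simp only [W, dif_neg h]; fun_prop
  have hD : ∀ s g, Differentiable ℝ fun θ => D s θ g := by
    intro s g
    fun_prop
  have hF : ∀ s, DifferentiableOn ℝ (F s) {θ | ∀ g, D s θ g ≠ 0} := by
    intro s
    refine differentiableOn_pi.2 fun j => ?_
    by_cases h : j ∈ Set.range s
    · simp only [F, if_pos h]
      have hσd : Differentiable ℝ (σ (f j)) := (σ (f j)).toContinuousLinearEquiv.differentiable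
      refine DifferentiableOn.fun_smul (DifferentiableOn.fun_inv (hD s _).differentiableOn
        fun θ hθ => hθ _) (Differentiable.differentiableOn ?_)
      fun_prop
    · simp only [F, if_neg h]
      exact (hP s j).differentiableOn
  have himage : ∀ s : {s : G → J // ∀ g, f (s g) = g},
      μ (F s '' {θ | (∀ g, D s θ g ≠ 0) ∧ θ.2.2.2 ∈ B}) = 0 := by
    rintro ⟨s, hs⟩
    have hsinj : Function.Injective s := Function.LeftInverse.injective hs
    have hK : Fintype.card (K s) + Fintype.card G = Fintype.card J := by
      have h1 := Fintype.card_subtype_compl (fun j => j ∈ Set.range s)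
      have h2 : Fintype.card {j // j ∈ Set.range s} = Fintype.card G :=
        Set.card_range_of_injective hsinj
      have h3 := Fintype.card_le_of_injective s hsinj
      simp only [K]
      omega
    -- Here the exact value of N makes the parameter space as large as the target, so the
    -- differentiable map `F` sends null sets to null sets.
    have hfin : Module.finrank ℝ (J → V) = Module.finrank ℝ ((K s → V) × (K s → ℝ) × V × V) := by
      simp only [Module.finrank_prod, Module.finrank_pi_fintype, Finset.sum_const,
        Finset.card_univ, smul_eq_mul, Module.finrank_self]
      rw [← hK] at hJ ⊢
      nlinarith
    let e : (J → V) ≃ₗ[ℝ] (K s → V) × (K s → ℝ) × V × V := LinearEquiv.ofFinrankEq _ _ hfin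
    let L : (J → V) →ₗ[ℝ] V := (LinearMap.snd ℝ V V ∘ₗ LinearMap.snd ℝ _ _ ∘ₗ
      LinearMap.snd ℝ _ _) ∘ₗ e.toLinearMap
    have hL : Function.Surjective L := fun v => ⟨e.symm (0, 0, 0, v), by simp [L]⟩
    have hnull : μ {x | L x ∈ B} = 0 := by
      have := (ae_comp_linearMap_mem_iff L μ ν hL hB.isOpen_compl.measurableSet).2
        (by simpa [ae_iff] using hB0)
      simpa [ae_iff] using this
    have hdiff : DifferentiableOn ℝ (F s ∘ e) (e ⁻¹' {θ | (∀ g, D s θ g ≠ 0) ∧ θ.2.2.2 ∈ B}) :=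
      ((hF s).mono fun θ hθ => hθ.1).comp
        e.toContinuousLinearEquiv.differentiable.differentiableOn (Set.mapsTo_preimage _ _)
    have := addHaar_image_eq_zero_of_differentiableOn_of_addHaar_eq_zero μ hdiff
      (measure_mono_null (fun x hx => hx.2) hnull)
    rwa [Set.image_comp, Set.image_preimage_eq _ e.surjective] at this
  refine measure_mono_null ?_ (measure_iUnion_null himage)
  rintro p ⟨w, -, hw1, a, v, hv, h⟩
  have hex : ∀ g, ∃ j, f j = g ∧ w j ≠ 0 := by
    intro g
    have : ∑ j with f j = g, w j ≠ 0 := by rw [hw1]; exact one_ne_zero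
    obtain ⟨j, hj, hj0⟩ := Finset.exists_ne_zero_of_sum_ne_zero this
    exact ⟨j, (Finset.mem_filter.1 hj).2, hj0⟩
  choose s hs hs0 using hex
  refine Set.mem_iUnion.2 ⟨⟨s, hs⟩, (fun k => p k, fun k => w k, a, v), ?_, ?_⟩
  all_goals
    have hDw : ∀ g, D s (fun k => p k, fun k => w k, a, v) g = w (s g) := fun g => by
      simp only [D, W]
      rw [sub_eq_iff_eq_add, ← hw1 g, sum_fiber_eq_add hs w g]
      simp only [dite_eq_ite]
  · exact ⟨fun g => by rw [hDw]; exact hs0 g, hv⟩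
  · funext j
    by_cases hj : j ∈ Set.range s
    · obtain ⟨g, rfl⟩ := hj
      simp only [F, if_pos (Set.mem_range_self g), hs]
      rw [hDw, inv_smul_eq_iff₀ (hs0 g), ← h g, sub_eq_iff_eq_add,
        sum_fiber_eq_add hs (fun j => w j • p j) g]
      congr 1
      refine Finset.sum_congr rfl fun j _ => ?_
      by_cases hj : j ∈ Set.range s
      · simp only [W, P, dif_pos hj, if_pos hj, zero_smul]
      · simp only [W, P, dif_neg hj, if_neg hj]
    · simp only [F, P, if_neg hj, dif_neg hj]

end Degenerate

/-! ### Vertices and isometries of an orbit polytope -/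

section OrbitPolytope

variable {d : ℕ} {G : Type*} [Group G] {σ : G →* (E d ≃ₗᵢ[ℝ] E d)}

/-- The orbit lies on a sphere, and every point of a sphere is extreme in its ball. -/
theorem vertexSet_orbit {a v : E d} (hv : v ≠ 0) :
    vertexSet (convexHull ℝ (Set.range fun g => a + σ g v)) = Set.range fun g => a + σ g v := by
  refine Set.Subset.antisymm extremePoints_convexHull_subset fun x hx => ?_
  have hsphere : Set.range (fun g => a + σ g v) ⊆ Metric.sphere a ‖v‖ := by
    rintro _ ⟨g, rfl⟩
    simp
  refine inter_extremePoints_subset_extremePoints_of_subset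
    (convexHull_min (hsphere.trans Metric.sphere_subset_closedBall) (convex_closedBall a ‖v‖))
    ⟨subset_convexHull ℝ _ hx, ?_⟩
  exact StrictConvexSpace.sphere_subset_extremePoints_closedBall a (by simpa using hv) (hsphere hx)

theorem image_convexHull_isometryEquiv (φ : E d ≃ᵢ E d) (s : Set (E d)) :
    φ '' convexHull ℝ s = convexHull ℝ (φ '' s) := by
  simpa using AffineMap.image_convexHull
    (φ.toRealAffineIsometryEquiv.toAffineEquiv : E d →ᵃ[ℝ] E d) s

theorem apply_mem_vertexSet {P : Set (E d)} {φ : E d ≃ᵢ E d} (hφ : φ ∈ isometryGroup P) {x : E d}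
    (hx : x ∈ vertexSet P) : φ x ∈ vertexSet P := by
  have himage : φ '' P = P := hφ
  refine mem_extremePoints_iff_left.2 ⟨himage ▸ Set.mem_image_of_mem φ hx.1, ?_⟩
  intro y₁ hy₁ y₂ hy₂ h
  rw [← himage] at hy₁ hy₂
  obtain ⟨x₁, hx₁, rfl⟩ := hy₁
  obtain ⟨x₂, hx₂, rfl⟩ := hy₂
  have := image_openSegment ℝ (φ.toRealAffineIsometryEquiv.toAffineEquiv : E d →ᵃ[ℝ] E d) x₁ x₂
  simp only [AffineEquiv.coe_coe, AffineIsometryEquiv.coe_toAffineEquiv,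
    IsometryEquiv.coeFn_toRealAffineIsometryEquiv] at this
  rw [← this] at h
  obtain ⟨z, hz, hzx⟩ := h
  rw [φ.injective hzx] at hz
  rw [(mem_extremePoints_iff_left.1 hx).2 x₁ hx₁ x₂ hx₂ hz]

/-- The orthogonal operator `σ g` applied with centre `a`. -/
def centredIsometry (σ : G →* (E d ≃ₗᵢ[ℝ] E d)) (a : E d) (g : G) : E d ≃ᵢ E d :=
  ((IsometryEquiv.subRight a).trans (σ g).toIsometryEquiv).trans (IsometryEquiv.addLeft a)

theorem centredIsometry_apply (a : E d) (g : G) (y : E d) :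
    centredIsometry σ a g y = a + σ g (y - a) := rfl

theorem mem_isometryGroup_orbit {a v : E d} {φ : E d ≃ᵢ E d} {g : G}
    (hφ : ∀ y, φ y = a + σ g (y - a)) :
    φ ∈ isometryGroup (convexHull ℝ (Set.range fun g => a + σ g v)) := by
  change φ '' _ = _
  rw [image_convexHull_isometryEquiv, ← Set.range_comp]
  congr 1
  have : (φ ∘ fun h => a + σ h v) = (fun h => a + σ h v) ∘ Equiv.mulLeft g := by
    funext h
    simp [hφ]
  rw [this, (Equiv.mulLeft g).surjective.range_comp]

variable [Fintype G]

theorem SpansEnd.affineSpan_orbit_eq_top (hσ : SpansEnd σ)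
    (hdim : 1 < Module.finrank ℝ (E d)) (a : E d) {v : E d} (hv : v ≠ 0) :
    affineSpan ℝ (Set.range fun g => a + σ g v) = ⊤ := by
  set S := affineSpan ℝ (Set.range fun g => a + σ g v)
  have hmem : ∀ g, a + σ g v ∈ S := fun g => subset_affineSpan ℝ _ ⟨g, rfl⟩
  have ha : a ∈ S := by
    apply convexHull_subset_affineSpan
    have := (convex_convexHull ℝ (Set.range fun g => a + σ g v)).sum_mem
      (t := Finset.univ) (w := fun _ : G => (Fintype.card G : ℝ)⁻¹) (z := fun g => a + σ g v)
      (fun _ _ => by positivity) (by simp) (fun g _ => subset_convexHull ℝ _ ⟨g, rfl⟩)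
    rwa [← Finset.smul_sum, Finset.sum_add_distrib, hσ.sum_apply_eq_zero hdim, add_zero,
      Finset.sum_const, Finset.card_univ, ← Nat.cast_smul_eq_nsmul ℝ, inv_smul_smul₀ (by simp)]
      at this
  refine eq_top_iff.2 fun y _ => ?_
  obtain ⟨c, hc⟩ := hσ.exists_sum_smul_apply_eq hv (y - a)
  have hdir : y - a ∈ S.direction := by
    rw [← hc]
    refine Submodule.sum_mem _ fun g _ => Submodule.smul_mem _ _ ?_
    simpa using AffineSubspace.vsub_mem_direction (hmem g) ha
  simpa using AffineSubspace.vadd_mem_of_mem_direction hdir ha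

/-- An orbit polytope has no isometries besides those from the group, if the group contains all
permutations of the orbit which preserve inner products. -/
theorem SpansEnd.exists_eq_of_mem_isometryGroup (hσ : SpansEnd σ)
    (hdim : 1 < Module.finrank ℝ (E d)) {a v : E d} (hv : v ≠ 0)
    (hinj : Function.Injective fun g => σ g v)
    (hgen : ∀ π : G → G, (∀ g h, inner ℝ (σ g v) (σ h v) = inner ℝ (σ (π g) v) (σ (π h) v)) →
      ∀ g, π g = π 1 * g) {φ : E d ≃ᵢ E d}
    (hφ : φ ∈ isometryGroup (convexHull ℝ (Set.range fun g => a + σ g v))) :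
    ∃ g, ∀ y, φ y = a + σ g (y - a) := by
  have hπ : ∀ g, ∃ h, a + σ h v = φ (a + σ g v) := fun g => by
    have := apply_mem_vertexSet hφ (x := a + σ g v) (by rw [vertexSet_orbit hv]; exact ⟨g, rfl⟩)
    rwa [vertexSet_orbit hv] at this
  choose π hπ using hπ
  have hπinj : Function.Injective π := fun g h hgh => by
    have : φ (a + σ g v) = φ (a + σ h v) := by rw [← hπ, ← hπ, hgh]
    exact hinj (add_left_cancel (φ.injective this))
  let A : E d ≃ₗᵢ[ℝ] E d := φ.toRealAffineIsometryEquiv.linearIsometryEquiv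
  have hA : ∀ y, φ y = φ a + A (y - a) := fun y => by
    have := φ.toRealAffineIsometryEquiv.map_vadd a (y - a)
    simp only [vadd_eq_add, sub_add_cancel, IsometryEquiv.coeFn_toRealAffineIsometryEquiv] at this
    rw [this, add_comm]
  have h1 : ∀ g, a + σ (π g) v = φ a + A (σ g v) := fun g => by
    rw [hπ, hA, add_sub_cancel_left]
  -- An isometry permutes the orbit, hence fixes its barycentre a.
  have ha : φ a = a := by
    have hsum : ∑ g, (a + σ (π g) v) = ∑ g, (φ a + A (σ g v)) :=
      Finset.sum_congr rfl fun g _ => h1 g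
    have hperm : ∑ g, σ (π g) v = ∑ g, σ g v :=
      Function.Bijective.sum_comp (Finite.injective_iff_bijective.1 hπinj) fun g => σ g v
    rw [Finset.sum_add_distrib, Finset.sum_add_distrib, ← map_sum A, hperm,
      hσ.sum_apply_eq_zero hdim, map_zero, add_zero, add_zero, Finset.sum_const, Finset.sum_const,
      ← Nat.cast_smul_eq_nsmul ℝ, ← Nat.cast_smul_eq_nsmul ℝ] at hsum
    exact (smul_right_injective (E d) (by simp : ((Finset.univ : Finset G).card : ℝ) ≠ 0) hsum).symm
  have h2 : ∀ g, σ (π g) v = A (σ g v) := fun g => by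
    have := h1 g
    rw [ha] at this
    exact add_left_cancel this
  have h3 := hgen π fun g h => by rw [h2, h2, LinearIsometryEquiv.inner_map_map]
  refine ⟨π 1, fun y => ?_⟩
  obtain ⟨c, hc⟩ := hσ.exists_sum_smul_apply_eq hv (y - a)
  rw [hA, ha, ← hc, map_sum, map_sum]
  congr 1
  refine Finset.sum_congr rfl fun g _ => ?_
  rw [map_smul, map_smul, ← h2, h3 g, map_mul]
  rfl

end OrbitPolytope

/-! ### Distinctness of generic points, and the main theorem -/

theorem isClosed_compl_setOf_injective {J V : Type*} [Finite J] [TopologicalSpace V] [T2Space V] :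
    IsClosed {p : J → V | Function.Injective p}ᶜ := by
  have : {p : J → V | Function.Injective p}ᶜ =
      ⋃ x : {x : J × J // x.1 ≠ x.2}, {p | p x.1.1 = p x.1.2} := by
    ext p
    simp only [Set.mem_compl_iff, Set.mem_ofPred_eq, Function.Injective, Set.mem_iUnion]
    push Not
    constructor
    · rintro ⟨i, j, h, hij⟩; exact ⟨⟨(i, j), hij⟩, h⟩
    · rintro ⟨⟨⟨i, j⟩, hij⟩, h⟩; exact ⟨i, j, h, hij⟩
  rw [this]
  exact isClosed_iUnion_of_finite fun x => isClosed_eq (continuous_apply _) (continuous_apply _)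

theorem measure_compl_setOf_injective {J V : Type*} [Fintype J] [NormedAddCommGroup V]
    [NormedSpace ℝ V] [FiniteDimensional ℝ V] [Nontrivial V] [MeasurableSpace V] [BorelSpace V]
    (μ : Measure (J → V)) [μ.IsAddHaarMeasure] :
    μ {p : J → V | Function.Injective p}ᶜ = 0 := by
  classical
  refine measure_mono_null (t := ⋃ x : {x : J × J // x.1 ≠ x.2},
    (LinearMap.eqLocus (LinearMap.proj x.1.1 : (J → V) →ₗ[ℝ] V) (LinearMap.proj x.1.2) :
      Set (J → V))) ?_ (measure_iUnion_null fun x => Measure.addHaar_submodule μ _ ?_)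
  · intro p hp
    simp only [Set.mem_compl_iff, Set.mem_ofPred_eq, Function.Injective] at hp
    push Not at hp
    obtain ⟨i, j, h, hij⟩ := hp
    exact Set.mem_iUnion.2 ⟨⟨(i, j), hij⟩, h⟩
  · intro htop
    obtain ⟨v, hv⟩ := exists_ne (0 : V)
    have : (Pi.single x.1.1 v : J → V) ∈ LinearMap.eqLocus
        (LinearMap.proj x.1.1 : (J → V) →ₗ[ℝ] V) (LinearMap.proj x.1.2) := by rw [htop]; trivial
    have h : v = (Pi.single x.1.1 v : J → V) x.1.2 := by simpa using this
    rw [Pi.single_eq_of_ne x.2.symm] at h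
    exact hv h

end OrbitTverberg

end

open OrbitTverberg MeasureTheory in
theorem corollary3p3 (d : ℕ) (hd : 2 ≤ d) {G : Type*} [Group G] [Finite G] (r : ℕ)
    (hr : Nat.card G = r) (ρ : G →* Matrix.orthogonalGroup (Fin d) ℝ)
    (hfaithful : Function.Injective ρ)
    (hirr : OrbitTverberg.IsAbsolutelyIrreducible ρ) :
    OrbitTverberg.GenericSet d ((r - 2) * (d + 1) + 2) (fun X =>
      ∃ P : Set (OrbitTverberg.E d), OrbitTverberg.IsPolytopeOn r P ∧
        OrbitTverberg.IsVertexTransitive P ∧ OrbitTverberg.IsometryGroupEq ρ P ∧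
        OrbitTverberg.CanBePartitioned r P X) := by
  classical
  have := Fintype.ofFinite G
  rw [Nat.card_eq_fintype_card] at hr
  set N := (r - 2) * (d + 1) + 2 with hN
  let σ := orthogonalAction ρ
  have hσ : SpansEnd σ := spansEnd_orthogonalAction hirr
  have hinj : Function.Injective σ := orthogonalAction_injective hfaithful
  have hrank : Module.finrank ℝ (E d) = d := by simp
  have hdim : 1 < Module.finrank ℝ (E d) := by omega
  have : Nontrivial (E d) := Module.nontrivial_of_finrank_pos (R := ℝ) (by omega)
  -- This keeps `r - 2` from truncating: a trivial group would fix a nonzero vector.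
  have hr2 : 2 ≤ r := by
    rw [← hr]
    by_contra! h
    have : Subsingleton G := Fintype.card_le_one_iff_subsingleton.1 (by omega)
    obtain ⟨v, hv⟩ := exists_ne (0 : E d)
    exact hv (hσ.eq_zero_of_invariant hdim fun g => by simp [Subsingleton.elim g 1])
  have hcard : Fintype.card G * (Module.finrank ℝ (E d) + 1) =
      Fintype.card (Fin N) + 2 * Module.finrank ℝ (E d) := by
    obtain ⟨k, rfl⟩ := Nat.exists_eq_add_of_le hr2
    rw [hrank, hr, Fintype.card_fin, hN, Nat.add_sub_cancel_left]
    ring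
  obtain ⟨B, hBclosed, hB0, hB⟩ :=
    hσ.exists_isClosed_measure_eq_zero (volume : Measure (E d)) hinj hdim
  let Z : Set (Fin N → E d) := {p | Function.Injective p}ᶜ ∪
    ⋃ f : Fin N → G, orbitPartitionSet σ f B
  have hZclosed : IsClosed Z := isClosed_compl_setOf_injective.union
    (isClosed_iUnion_of_finite fun f => hσ.isClosed_orbitPartitionSet hdim f hBclosed)
  have hZ0 : volume Z = 0 := measure_union_null (measure_compl_setOf_injective _)
    (measure_iUnion_null fun f =>
      measure_orbitPartitionSet_eq_zero volume volume f hBclosed hB0 hcard)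
  refine ⟨Zᶜ, hZclosed.isOpen_compl, ?_, by rwa [compl_compl], fun p hp => ?_⟩
  · rw [← interior_eq_empty_iff_dense_compl]
    exact Measure.interior_eq_empty_of_null hZ0
  have hp1 : Function.Injective p := by
    by_contra h
    exact hp (Or.inl h)
  refine ⟨hp1, ?_⟩
  obtain ⟨f, w, hw0, hw1, a, v, hx⟩ := hσ.exists_partition hdim hcard.le p
  have hvB : v ∉ B := fun hvB =>
    hp (Or.inr (Set.mem_iUnion.2 ⟨f, w, hw0, hw1, a, v, hvB, hx⟩))
  obtain ⟨hvinj, hgen⟩ := hB v hvB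
  have hv : v ≠ 0 := by
    rintro rfl
    have : Nontrivial G := Fintype.one_lt_card_iff_nontrivial.1 (by omega)
    obtain ⟨g, hg⟩ := exists_ne (1 : G)
    exact hg (hvinj (by simp))
  have hvert := vertexSet_orbit (σ := σ) (a := a) hv
  have hfin : (Set.range fun g => a + σ g v).Finite := Set.finite_range _
  refine ⟨convexHull ℝ (Set.range fun g => a + σ g v), ⟨⟨_, hfin, rfl⟩, ?_, ?_, ?_⟩, ?_,
    ⟨a, fun φ => ⟨fun hφ => ?_, ?_⟩⟩, ?_⟩
  · rw [affineSpan_convexHull]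
    exact hσ.affineSpan_orbit_eq_top hdim a hv
  · rwa [hvert]
  · rw [hvert, ← Set.image_univ, Set.ncard_image_of_injective _ fun g h hgh =>
      hvinj (add_left_cancel hgh), Set.ncard_univ, Nat.card_eq_fintype_card, hr]
  · rw [IsVertexTransitive, hvert]
    rintro _ ⟨g, rfl⟩ _ ⟨h, rfl⟩
    refine ⟨centredIsometry σ a (h * g⁻¹), mem_isometryGroup_orbit fun y => rfl, ?_⟩
    simp [centredIsometry_apply]
  · exact hσ.exists_eq_of_mem_isometryGroup hdim hv hvinj hgen hφ
  · rintro ⟨g, hg⟩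
    exact mem_isometryGroup_orbit (σ := σ) (g := g) hg
  · let e : Fin r ≃ G := (Fintype.equivFinOfCardEq hr).symm
    refine ⟨fun i => p '' {j | f j = e i}, fun i => ?_, fun i k hik => ?_, ?_,
      fun i => a + σ (e i) v, fun i => ?_, ?_⟩
    · have : ∑ j with f j = e i, w j ≠ 0 := by rw [hw1]; exact one_ne_zero
      obtain ⟨j, hj, -⟩ := Finset.exists_ne_zero_of_sum_ne_zero this
      exact ⟨p j, j, (Finset.mem_filter.1 hj).2, rfl⟩
    · refine Set.disjoint_image_of_injective hp1 (Set.disjoint_left.2 fun j hj hj' => hik ?_)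
      exact e.injective (Eq.trans (Eq.symm hj) hj')
    · rw [← Set.image_iUnion, ← Set.image_univ]
      congr 1
      exact Set.eq_univ_of_forall fun j => Set.mem_iUnion.2 ⟨e.symm (f j), by simp⟩
    · beta_reduce
      rw [← hx]
      exact (convex_convexHull ℝ _).sum_mem (fun j _ => hw0 j) (hw1 _) fun j hj =>
        subset_convexHull ℝ _ ⟨j, (Finset.mem_filter.1 hj).2, rfl⟩
    · rw [hvert]
      exact e.surjective.range_comp fun g => a + σ g v
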